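/- Let $R$ be an artin algebra (a ring that is finitely generated as a module over some commutative artinian ring over which it is an algebra), let $\mathrm{mod}\,R$ be the category of finitely generated left $R$-modules, and let $\mathcal D^b(\mathrm{mod}\,R)$ be its bounded derived category. For $T\in\mathcal D^b(\mathrm{mod}\,R)$ let $\mathrm{add}\,T$ be the class of direct summands of finite direct sums of copies of $T$, and let ${}^{\perp_{k>0}}T$ be the class of objects $X$ with $\mathrm{Hom}(X,T[k])=0$ for all $k>0$. Call $T$ *semi-selforthogonal* if $\mathrm{Hom}(T,T[k])=0$ for all $k>0$. For a finite interval $I$ of integers let $\mathcal D^I(\mathrm{mod}\,R)$ be the class of objects whose cohomology is concentrated in degrees in $I$, and let $\mathcal X_T^I$ be the class of objects $X$ for which there are distinguished triangles $$X_i\to T_i\to X_{i+1}\to X_i[1]\qquad(i\ge 0)$$ with $X_0=X$, all $T_i\in\mathrm{add}\,T$ and all $X_i\in{}^{\perp_{k>0}}T\cap\mathcal D^I(\mathrm{mod}\,R)$. Let $\mathcal X_T^\flat$ be the union of the classes $\mathcal X_T^I$ over all finite intervals $I$ with $T\in\mathcal D^I(\mathrm{mod}\,R)$, and let $\langle\mathcal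 X_T^\flat\rangle_+$ be the class of all objects isomorphic to $C[n]$ with $C\in\mathcal X_T^\flat$ and $n\ge 0$. The complex $T$ is *Wakamatsu-silting* if it is semi-selforthogonal and $R$, viewed as a complex concentrated in degree $0$, lies in $\langle\mathcal X_T^\flat\rangle_+$. **Corollary.** Let $R$ and $S$ be artin algebras and let $F:\mathcal D^b(\mathrm{mod}\,R)\to\mathcal D^b(\mathrm{mod}\,S)$ be a triangle functor that is an equivalence of categories. Then for every $T\in\mathcal D^b(\mathrm{mod}\,R)$, $T$ is Wakamatsu-silting if and only if $F(T)$ is Wakamatsu-silting. -/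

import Mathlib

open CategoryTheory Limits Pretriangulated

universe w w' v u

/-- `R` is an artin algebra: it is an algebra over some commutative artinian ring `k` and is
finitely generated as a `k`-module. (Replacing `k` by its image in the centre of `R`, one may
always take `k` in the universe of `R`.) -/
class IsArtinAlgebra (R : Type u) [Ring R] : Prop where
  exists_base : ∃ (k : Type u) (_ : CommRing k) (_ : Algebra k R),
    IsArtinianRing k ∧ Module.Finite k R

/-- An artin algebra is (left) noetherian, so that its finitely generated left modules form an
abelian category. -/
instance IsArtinAlgebra.isNoetherianRing (R : Type u) [Ring R] [IsArtinAlgebra R] :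
    IsNoetherianRing R := by
  obtain ⟨k, _, _, _, _⟩ := IsArtinAlgebra.exists_base (R := R)
  have : IsNoetherian k R := inferInstance
  exact isNoetherian_of_tower k this

namespace WakamatsuSilting

noncomputable section

section Triangulated

variable {D : Type u} [Category.{v} D] [Preadditive D] [HasZeroObject D] [HasShift D ℤ]
  [∀ n : ℤ, (shiftFunctor D n).Additive] [Pretriangulated D]

/-- `add M`: the direct summands of finite direct sums of copies of `M`. -/
def addClosure (M : D) : ObjectProperty D := fun N =>
  ∃ (n : ℕ) (N' : D), Nonempty (N ⊞ N' ≅ ⨁ fun _ : Fin n => M)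

/-- `^{⊥_{k>0}} M`: the objects `X` with `Hom(X, M[k]) = 0` for all `k > 0`. -/
def leftPerpPos (M : D) : ObjectProperty D := fun X =>
  ∀ k : ℤ, 0 < k → ∀ f : X ⟶ M⟦k⟧, f = 0

/-- `M` is semi-selforthogonal: `Hom(M, M[k]) = 0` for all `k > 0`. -/
def IsSemiSelforthogonal (M : D) : Prop :=
  ∀ k : ℤ, 0 < k → ∀ f : M ⟶ M⟦k⟧, f = 0

/-- `⟨𝒞⟩₊`: the objects isomorphic to `C[n]` for some `C` in `𝒞` and some integer `n ≥ 0`. -/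
def nonnegShifts (P : ObjectProperty D) : ObjectProperty D := fun X =>
  ∃ (C : D) (n : ℤ), P C ∧ 0 ≤ n ∧ Nonempty (X ≅ C⟦n⟧)

end Triangulated

section Derived

variable {A : Type u} [Category.{v} A] [Abelian A] [HasDerivedCategory.{w} A]

/-- `D^{[a,b]}(A)`: the objects of `D^b(A)` whose cohomology is concentrated in `[a, b]`. -/
def homologyIn (a b : ℤ) : ObjectProperty (DerivedCategory.Bounded A) := fun X =>
  ∀ i : ℤ, i ∉ Set.Icc a b → IsZero ((DerivedCategory.homologyFunctor A i).obj X.obj)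

/-- `𝒳_M^{[a,b]}`: the objects `X` in `^{⊥_{k>0}} M` for which there are distinguished triangles
`X_i ⟶ M_i ⟶ X_{i+1} ⟶ X_i[1]` for `i ≥ 0`, with `X_0 = X`, every `M_i` in `add M` and every
`X_i` in `^{⊥_{k>0}} M ∩ D^{[a,b]}(A)`. -/
def coAuslanderIn (M : DerivedCategory.Bounded A) (a b : ℤ) :
    ObjectProperty (DerivedCategory.Bounded A) := fun X =>
  leftPerpPos M X ∧
  ∃ (Y N : ℕ → DerivedCategory.Bounded A),
    Nonempty (Y 0 ≅ X) ∧
    (∀ i, addClosure M (N i)) ∧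
    (∀ i, leftPerpPos M (Y i) ∧ homologyIn a b (Y i)) ∧
    ∀ i, ∃ (f : Y i ⟶ N i) (g : N i ⟶ Y (i + 1)) (h : Y (i + 1) ⟶ (Y i)⟦(1 : ℤ)⟧),
      Triangle.mk f g h ∈ distTriang (DerivedCategory.Bounded A)

/-- The co-Auslander class `𝒳_M^♭`: the union of the classes `𝒳_M^{[a,b]}` over all finite
intervals `[a, b]` such that `M` lies in `D^{[a,b]}(A)`. -/
def coAuslander (M : DerivedCategory.Bounded A) :
    ObjectProperty (DerivedCategory.Bounded A) := fun X =>
  ∃ a b : ℤ, homologyIn a b M ∧ coAuslanderIn M a b X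

end Derived

section Algebra

variable (R : Type u) [Ring R] [IsArtinAlgebra R] [HasDerivedCategory.{w} (FGModuleCat.{u} R)]

/-- `D^b(mod R)`, the bounded derived category of finitely generated left `R`-modules. -/
abbrev Db := DerivedCategory.Bounded (FGModuleCat.{u} R)

/-- The regular module `R` as a stalk complex in degree `0`, an object of `D^b(mod R)`. -/
def regular : Db R :=
  ⟨(DerivedCategory.singleFunctor (FGModuleCat.{u} R) 0).obj (FGModuleCat.of R R),
    ⟨0, inferInstance⟩, ⟨0, inferInstance⟩⟩

variable {R}

/-- `T ∈ D^b(mod R)` is Wakamatsu-silting if it is semi-selforthogonal and `R ∈ ⟨𝒳_T^♭⟩₊`. -/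
def IsWakamatsuSilting (T : Db R) : Prop :=
  IsSemiSelforthogonal T ∧ nonnegShifts (coAuslander T) (regular R)

end Algebra

end

end WakamatsuSilting

/-! The class `⟨𝒳_T^♭⟩₊` is a thick subcategory: a horseshoe argument, run coinductively along the
coresolutions, shows that `𝒳_T^♭` is closed under extensions and direct summands, and `𝒳_T^♭` is
closed under negative shifts. A triangle functor `F` maps `D^{[a,b]}` into some `D^{[a',b']}`,
because every object of `D^{[a,b]}` is an iterated extension of direct summands of shifts of a
single module; if `F` is full, it therefore maps `⟨𝒳_T^♭⟩₊` into `⟨𝒳_{F T}^♭⟩₊`. For an equivalence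
`F` it remains to see that `S ∈ ⟨𝒳_{F T}^♭⟩₊` as soon as this thick subcategory contains `F R`. Now
`F⁻¹ S` has finite projective dimension, again because `F` is bounded, so it lies in the thick
subcategory generated by `R`; hence `S` lies in the one generated by `F R`.
-/

namespace WakamatsuSilting

section Triangles

variable {D : Type u} [Category.{v} D] [Preadditive D] [HasZeroObject D] [HasShift D ℤ]
  [∀ n : ℤ, (shiftFunctor D n).Additive] [Pretriangulated D]

/-- There is a distinguished triangle `X ⟶ Y ⟶ Z ⟶ X⟦1⟧`. Membership in a class closed under
extensions depends only on the three objects, so the morphisms are left implicit. -/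
def HasTriangle (X Y Z : D) : Prop :=
  ∃ (f : X ⟶ Y) (g : Y ⟶ Z) (h : Z ⟶ X⟦(1 : ℤ)⟧), Triangle.mk f g h ∈ distTriang D

namespace HasTriangle

variable {X Y Z : D}

lemma of_distTriang (T : Triangle D) (hT : T ∈ distTriang D) :
    HasTriangle T.obj₁ T.obj₂ T.obj₃ :=
  ⟨_, _, _, hT⟩

lemma of_iso {X' Y' Z' : D} (H : HasTriangle X Y Z) (e₁ : X ≅ X') (e₂ : Y ≅ Y')
    (e₃ : Z ≅ Z') : HasTriangle X' Y' Z' := by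
  obtain ⟨f, g, h, H⟩ := H
  exact ⟨e₁.inv ≫ f ≫ e₂.hom, e₂.inv ≫ g ≫ e₃.hom, e₃.inv ≫ h ≫ e₁.hom⟦1⟧',
    isomorphic_distinguished _ H _ (Triangle.isoMk _ _ e₁.symm e₂.symm e₃.symm
      (show (e₁.inv ≫ f ≫ e₂.hom) ≫ e₂.inv = e₁.inv ≫ f by simp)
      (show (e₂.inv ≫ g ≫ e₃.hom) ≫ e₃.inv = e₂.inv ≫ g by simp)
      (show (e₃.inv ≫ h ≫ e₁.hom⟦1⟧') ≫ e₁.inv⟦1⟧' = e₃.inv ≫ h by simp [← Functor.map_comp]))⟩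

lemma rotate (H : HasTriangle X Y Z) : HasTriangle Y Z (X⟦(1 : ℤ)⟧) := by
  obtain ⟨f, g, h, H⟩ := H
  exact .of_distTriang _ (rot_of_distTriang _ H)

lemma invRotate (H : HasTriangle X Y Z) : HasTriangle (Z⟦(-1 : ℤ)⟧) X Y := by
  obtain ⟨f, g, h, H⟩ := H
  exact .of_distTriang _ (inv_rot_of_distTriang _ H)

lemma shift (H : HasTriangle X Y Z) (n : ℤ) : HasTriangle (X⟦n⟧) (Y⟦n⟧) (Z⟦n⟧) := by
  obtain ⟨f, g, h, H⟩ := H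
  exact .of_distTriang _ (Triangle.shift_distinguished _ H n)

lemma prop₂ (H : HasTriangle X Y Z) (P : ObjectProperty D) [P.IsTriangulatedClosed₂]
    [P.IsClosedUnderIsomorphisms] (hX : P X) (hZ : P Z) : P Y := by
  obtain ⟨f, g, h, H⟩ := H
  exact P.ext_of_isTriangulatedClosed₂ _ H hX hZ

lemma of_isZero (hX : IsZero X) (hY : IsZero Y) (hZ : IsZero Z) : HasTriangle X Y Z :=
  of_iso ⟨𝟙 X, 0, 0, contractible_distinguished X⟩ (Iso.refl X) (hX.iso hY)
    ((isZero_zero D).iso hZ)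

lemma nonempty_iso_biprod (H : HasTriangle X Y Z) (h0 : ∀ w : Z ⟶ X⟦(1 : ℤ)⟧, w = 0) :
    Nonempty (Y ≅ X ⊞ Z) := by
  obtain ⟨f, g, w, H⟩ := H
  obtain ⟨e, -⟩ := exists_iso_binaryBiproduct_of_distTriang _ H (h0 w)
  exact ⟨e⟩

end HasTriangle

lemma exists_complement_of_retract {X Y : D} (r : Retract Y X) :
    ∃ Y' : D, HasTriangle Y X Y' ∧ Nonempty (X ≅ Y ⊞ Y') := by
  obtain ⟨Y', p, w, hT⟩ := distinguished_cocone_triangle r.i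
  obtain ⟨e, -⟩ := exists_iso_binaryBiproduct_of_distTriang _ hT
    (Triangle.mor₃_eq_zero_of_mono₁ _ hT (inferInstanceAs (Mono r.i)))
  exact ⟨Y', ⟨_, _, _, hT⟩, ⟨e⟩⟩

variable [IsTriangulated D] {X Y Z N M X' Z' : D}

lemma HasTriangle.exists_comp (hY : HasTriangle X Y Z) (hN : HasTriangle Y N X') :
    ∃ W : D, HasTriangle X N W ∧ HasTriangle Z W X' := by
  obtain ⟨f, _, _, hf⟩ := hY
  obtain ⟨g, _, _, hg⟩ := hN
  obtain ⟨W, _, _, hW⟩ := distinguished_cocone_triangle (f ≫ g)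
  exact ⟨W, ⟨_, _, _, hW⟩, .of_distTriang _ (Triangulated.someOctahedron rfl hf hg hW).mem⟩

lemma HasTriangle.exists_cobaseChange (hY : HasTriangle X Y Z) (hN : HasTriangle X N X') :
    ∃ E : D, HasTriangle N E Z ∧ HasTriangle Y E X' := by
  obtain ⟨E, hE, hE'⟩ := hY.invRotate.exists_comp hN
  exact ⟨E, hE.rotate.of_iso (Iso.refl N) (Iso.refl E) ((shiftEquiv D (1 : ℤ)).counitIso.app Z),
    hE'⟩

lemma HasTriangle.biprod_left (hM : HasTriangle Z M Z') (N : D) :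
    HasTriangle (N ⊞ Z) (N ⊞ M) Z' := by
  obtain ⟨g, g', g'', hg⟩ := hM
  obtain ⟨V, c, d, hV⟩ := distinguished_cocone_triangle (biprod.map (𝟙 N) g)
  let o := Triangulated.someOctahedron
    (show biprod.inl ≫ biprod.map (𝟙 N) g = biprod.inl by simp)
    (binaryBiproductTriangle_distinguished N Z) hV (binaryBiproductTriangle_distinguished N M)
  have hm : o.m₁ = g := by
    rw [← cancel_epi (biprod.snd : N ⊞ Z ⟶ Z)]
    exact o.comm₁.trans (biprod.map_snd _ _)
  have ho := o.mem
  rw [hm] at ho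
  exact .of_iso ⟨_, _, _, hV⟩ (Iso.refl _) (Iso.refl _) (Triangle.π₃.mapIso
    (isoTriangleOfIso₁₂ _ _ ho hg (Iso.refl Z) (Iso.refl M)
      (show g ≫ 𝟙 M = 𝟙 Z ≫ g by simp)))

lemma HasTriangle.exists_horseshoe (hY : HasTriangle X Y Z) (hX : HasTriangle X N X')
    (hZ : HasTriangle Z M Z') (h0 : ∀ φ : Z ⟶ N⟦(1 : ℤ)⟧, φ = 0) :
    ∃ Y' : D, HasTriangle Y (N ⊞ M) Y' ∧ HasTriangle X' Y' Z' := by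
  obtain ⟨E, hE, hYE⟩ := hY.exists_cobaseChange hX
  obtain ⟨e⟩ := hE.nonempty_iso_biprod h0
  have hE' : HasTriangle E (N ⊞ M) Z' :=
    (hZ.biprod_left N).of_iso e.symm (Iso.refl _) (Iso.refl _)
  exact hYE.exists_comp hE'

lemma HasTriangle.exists_lift {P C : D} (hX : HasTriangle X Y Z) (hP : HasTriangle P Z C)
    (h0 : ∀ φ : P ⟶ X⟦(1 : ℤ)⟧, φ = 0) :
    ∃ V : D, HasTriangle P Y V ∧ HasTriangle X V C := by
  obtain ⟨f, g, δ, hg⟩ := hX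
  obtain ⟨π, k, k', hπ⟩ := hP
  obtain ⟨l, hl⟩ : ∃ l : P ⟶ Y, π = l ≫ g := Triangle.coyoneda_exact₃ _ hg π (h0 _)
  obtain ⟨V, _, _, hV⟩ := distinguished_cocone_triangle l
  have hVC : HasTriangle V C (X⟦(1 : ℤ)⟧) := .of_distTriang _
    (Triangulated.someOctahedron hl.symm hV (rot_of_distTriang _ hg) hπ).mem
  exact ⟨V, ⟨_, _, _, hV⟩, hVC.invRotate.of_iso ((shiftEquiv D (1 : ℤ)).unitIso.symm.app X)
    (Iso.refl V) (Iso.refl C)⟩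

end Triangles

section Coresolutions

variable {D : Type u} [Category.{v} D] [Preadditive D] [HasZeroObject D] [HasShift D ℤ]
  [∀ n : ℤ, (shiftFunctor D n).Additive] [Pretriangulated D]

/-- The objects `X` with a `P`-coresolution in `Q`: there are triangles
`Y i ⟶ N i ⟶ Y (i + 1) ⟶ (Y i)⟦1⟧` with `Y 0 ≅ X`, all `N i` in `P` and all `Y i` in `Q`. -/
def HasCoresolution (P Q : ObjectProperty D) : ObjectProperty D := fun X =>
  ∃ Y N : ℕ → D, Nonempty (Y 0 ≅ X) ∧ (∀ i, P (N i)) ∧ (∀ i, Q (Y i)) ∧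
    ∀ i, HasTriangle (Y i) (N i) (Y (i + 1))

namespace HasCoresolution

variable {P Q : ObjectProperty D} {X : D}

instance : (HasCoresolution P Q).IsClosedUnderIsomorphisms where
  of_iso := by
    rintro X X' e ⟨Y, N, ⟨e'⟩, h⟩
    exact ⟨Y, N, ⟨e' ≪≫ e⟩, h⟩

lemma prop [Q.IsClosedUnderIsomorphisms] (h : HasCoresolution P Q X) : Q X := by
  obtain ⟨Y, N, ⟨e⟩, _, hY, _⟩ := h
  exact Q.prop_of_iso e (hY 0)

lemma exists_step (h : HasCoresolution P Q X) :
    ∃ N X' : D, P N ∧ HasCoresolution P Q X' ∧ HasTriangle X N X' := by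
  obtain ⟨Y, N, ⟨e⟩, hN, hY, hT⟩ := h
  exact ⟨N 0, Y 1, hN 0, ⟨fun i => Y (i + 1), fun i => N (i + 1), ⟨Iso.refl _⟩, fun i => hN _,
    fun i => hY _, fun i => hT _⟩, (hT 0).of_iso e (Iso.refl _) (Iso.refl _)⟩

/-- Coinduction: `HasCoresolution P Q` is the largest class contained in `Q` all of whose objects
map to an object of `P` with cone in the class. -/
lemma le_of_forall_exists_step {C : ObjectProperty D} (hQ : C ≤ Q)
    (hC : ∀ X, C X → ∃ N X' : D, P N ∧ C X' ∧ HasTriangle X N X') :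
    C ≤ HasCoresolution P Q := by
  choose N X' hN hX' hT using hC
  intro X hX
  let s : ℕ → {X // C X} := fun n => Nat.rec ⟨X, hX⟩ (fun _ Z => ⟨X' Z.1 Z.2, hX' _ _⟩) n
  exact ⟨fun i => (s i).1, fun i => N _ (s i).2, ⟨Iso.refl _⟩, fun i => hN _ _,
    fun i => hQ _ (s i).2, fun i => hT _ _⟩

lemma cons {N X' : D} (hX : Q X) (hN : P N) (hT : HasTriangle X N X')
    (hX' : HasCoresolution P Q X') : HasCoresolution P Q X := by
  obtain ⟨Y, M, ⟨e⟩, hM, hY, hYM⟩ := hX'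
  refine ⟨fun i => Nat.casesOn i X Y, fun i => Nat.casesOn i N M, ⟨Iso.refl X⟩, ?_, ?_, ?_⟩
  · rintro (_ | i)
    exacts [hN, hM i]
  · rintro (_ | i)
    exacts [hX, hY i]
  · rintro (_ | i)
    exacts [hT.of_iso (Iso.refl X) (Iso.refl N) e.symm, hYM i]

lemma of_isZero (hX : IsZero X) (hP : P X) (hQ : Q X) : HasCoresolution P Q X :=
  ⟨fun _ => X, fun _ => X, ⟨Iso.refl X⟩, fun _ => hP, fun _ => hQ, fun _ => .of_isZero hX hX hX⟩

lemma mono {Q' : ObjectProperty D} (h : Q ≤ Q') :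
    HasCoresolution P Q ≤ HasCoresolution P Q' := by
  rintro X ⟨Y, N, e, hN, hY, hT⟩
  exact ⟨Y, N, e, hN, fun i => h _ (hY i), hT⟩

variable [IsTriangulated D] (hP : ∀ M N, P M → P N → P (M ⊞ N))
  (h0 : ∀ Z N : D, Q Z → P N → ∀ φ : Z ⟶ N⟦(1 : ℤ)⟧, φ = 0)

include hP h0

lemma isTriangulatedClosed₂ [Q.IsClosedUnderIsomorphisms] [Q.IsTriangulatedClosed₂] :
    (HasCoresolution P Q).IsTriangulatedClosed₂ := by
  refine .mk' fun T hT h₁ h₃ => le_of_forall_exists_step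
    (C := fun Y => ∃ X Z, HasCoresolution P Q X ∧ HasCoresolution P Q Z ∧ HasTriangle X Y Z)
    ?_ ?_ _ ⟨_, _, h₁, h₃, .of_distTriang T hT⟩
  · rintro Y ⟨X, Z, hX, hZ, h⟩
    exact h.prop₂ Q hX.prop hZ.prop
  · rintro Y ⟨X, Z, hX, hZ, h⟩
    obtain ⟨N, X', hN, hX', hT⟩ := hX.exists_step
    obtain ⟨M, Z', hM, hZ', hT'⟩ := hZ.exists_step
    obtain ⟨Y', hY, hY'⟩ := h.exists_horseshoe hT hT' (h0 _ _ hZ.prop hN)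
    exact ⟨N ⊞ M, Y', hP _ _ hN hM, ⟨X', Z', hX', hZ', hY'⟩, hY⟩

lemma isStableUnderRetracts [Q.IsTriangulatedClosed₂] [Q.IsStableUnderRetracts] :
    (HasCoresolution P Q).IsStableUnderRetracts := by
  have := isTriangulatedClosed₂ hP h0
  refine ⟨fun {Y X} r hX => le_of_forall_exists_step
    (C := (HasCoresolution P Q).retractClosure) ?_ ?_ _ ⟨X, hX, ⟨r⟩⟩⟩
  · rintro Y ⟨X, hX, ⟨r⟩⟩
    exact Q.prop_of_retract r hX.prop
  · rintro Y ⟨X, hX, ⟨r⟩⟩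
    obtain ⟨Y', hYX, ⟨e⟩⟩ := exists_complement_of_retract r
    obtain ⟨N, X', hN, hX', hXN⟩ := hX.exists_step
    obtain ⟨W, hW, ⟨f, g, h, hW'⟩⟩ := hYX.exists_comp hXN
    have hY' : (HasCoresolution P Q).retractClosure Y' :=
      ⟨X, hX, ⟨(⟨biprod.inr, biprod.snd, by simp⟩ : Retract Y' (Y ⊞ Y')).trans (.ofIso e.symm)⟩⟩
    refine ⟨N, W, hN, ObjectProperty.monotone_retractClosure
      (ObjectProperty.extensionProduct_le_of_isTriangulatedClosed₂ le_rfl le_rfl) _ ?_, hW⟩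
    exact ObjectProperty.extensionProduct_retractClosure_retractClosure_le _ _ _
      ⟨_, _, _, _, _, hW', hY', ObjectProperty.le_retractClosure _ _ hX'⟩

end HasCoresolution

end Coresolutions

section Classes

lemma eq_zero_of_full {C : Type*} [Category* C] [HasZeroMorphisms C] {D : Type*} [Category* D]
    [HasZeroMorphisms D] (G : C ⥤ D) [G.Full] [G.PreservesZeroMorphisms] {X Y : C}
    (h : ∀ f : X ⟶ Y, f = 0) {Y' : D} (e : G.obj Y ≅ Y') (f : G.obj X ⟶ Y') : f = 0 := by
  obtain ⟨g, hg⟩ := G.map_surjective (f ≫ e.inv)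
  rw [← cancel_mono e.inv, ← hg, h g, G.map_zero, zero_comp]

instance isStableUnderRetracts_inf {C : Type*} [Category* C] (P Q : ObjectProperty C)
    [P.IsStableUnderRetracts] [Q.IsStableUnderRetracts] : (P ⊓ Q).IsStableUnderRetracts where
  of_retract r h := ⟨P.prop_of_retract r h.1, Q.prop_of_retract r h.2⟩

instance isStableUnderRetracts_inverseImage {C : Type*} [Category* C] {D : Type*} [Category* D]
    (F : C ⥤ D) (P : ObjectProperty D) [P.IsStableUnderRetracts] :
    (P.inverseImage F).IsStableUnderRetracts where
  of_retract r h := P.prop_of_retract (r.map F) h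

variable {D : Type*} [Category* D] [Preadditive D] [HasShift D ℤ]

instance isStableUnderRetracts_leftPerpPos (M : D) : (leftPerpPos M).IsStableUnderRetracts where
  of_retract r h k hk f := by
    rw [← Category.id_comp f, ← r.retract, Category.assoc, h k hk (r.r ≫ f), comp_zero]

lemma leftPerpPos_of_isZero (M : D) {X : D} (h : IsZero X) : leftPerpPos M X :=
  fun _ _ _ => h.eq_of_src _ _

lemma leftPerpPos_le_of_iso {M M' : D} (e : M ≅ M') : leftPerpPos M ≤ leftPerpPos M' :=
  fun _ h k hk => eq_zero_of_full (𝟭 D) (h k hk) ((shiftFunctor D k).mapIso e)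

lemma leftPerpPos.map {C : Type*} [Category* C] [Preadditive C] [HasShift C ℤ] {M X : C}
    (h : leftPerpPos M X) (F : C ⥤ D) [F.CommShift ℤ] [F.Full] [F.PreservesZeroMorphisms] :
    leftPerpPos (F.obj M) (F.obj X) := fun k hk =>
  eq_zero_of_full F (h k hk) ((F.commShiftIso k).app M)

variable [∀ n : ℤ, (shiftFunctor D n).Additive]

lemma leftPerpPos_le_shift (M : D) {n : ℤ} (hn : n ≤ 0) :
    leftPerpPos M ≤ (leftPerpPos M).shift n := fun _ h k hk =>
  eq_zero_of_full (shiftFunctor D n) (h (k - n) (by lia))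
    ((shiftFunctorAdd' D (k - n) n k (by lia)).symm.app M)

variable [HasZeroObject D] [Pretriangulated D]

lemma addClosure_iff {M N : D} :
    addClosure M N ↔
      ∃ (n : ℕ) (p : Fin n → (N ⟶ M)) (i : Fin n → (M ⟶ N)), ∑ j, p j ≫ i j = 𝟙 N := by
  constructor
  · rintro ⟨n, N', ⟨e⟩⟩
    let π := biproduct.π fun _ : Fin n => M
    let ι := biproduct.ι fun _ : Fin n => M
    have hπι : ∑ j, π j ≫ ι j = 𝟙 _ := biproduct.total
    refine ⟨n, fun j => biprod.inl ≫ e.hom ≫ π j, fun j => ι j ≫ e.inv ≫ biprod.fst, ?_⟩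
    calc ∑ j, (biprod.inl ≫ e.hom ≫ π j) ≫ ι j ≫ e.inv ≫ biprod.fst
        = biprod.inl ≫ e.hom ≫ (∑ j, π j ≫ ι j) ≫ e.inv ≫ biprod.fst := by
          simp only [Preadditive.comp_sum, Preadditive.sum_comp, Category.assoc]
      _ = 𝟙 N := by simp [hπι]
  · rintro ⟨n, p, i, hpi⟩
    obtain ⟨N', -, ⟨e⟩⟩ := exists_complement_of_retract (X := ⨁ fun _ : Fin n => M)
      ⟨biproduct.lift p, biproduct.desc i, by rw [biproduct.lift_desc, hpi]⟩
    exact ⟨n, N', ⟨e.symm⟩⟩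

lemma addClosure_of_isZero (M : D) {N : D} (h : IsZero N) : addClosure M N :=
  addClosure_iff.2 ⟨0, Fin.elim0, Fin.elim0, h.eq_of_src _ _⟩

lemma addClosure_biprod {M N N' : D} (h : addClosure M N) (h' : addClosure M N') :
    addClosure M (N ⊞ N') := by
  obtain ⟨n, p, i, hpi⟩ := addClosure_iff.1 h
  obtain ⟨n', p', i', hpi'⟩ := addClosure_iff.1 h'
  refine addClosure_iff.2 ⟨n + n',
    Fin.append (fun j => biprod.fst ≫ p j) fun j => biprod.snd ≫ p' j,
    Fin.append (fun j => i j ≫ biprod.inl) fun j => i' j ≫ biprod.inr, ?_⟩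
  rw [Fin.sum_univ_add]
  simp only [Fin.append_left, Fin.append_right]
  calc (∑ j, (biprod.fst ≫ p j) ≫ i j ≫ biprod.inl) + ∑ j, (biprod.snd ≫ p' j) ≫ i' j ≫ biprod.inr
      = biprod.fst ≫ (∑ j, p j ≫ i j) ≫ biprod.inl +
          biprod.snd ≫ (∑ j, p' j ≫ i' j) ≫ biprod.inr := by
        simp only [Preadditive.comp_sum, Preadditive.sum_comp, Category.assoc]
    _ = 𝟙 (N ⊞ N') := by rw [hpi, hpi', Category.id_comp, Category.id_comp, biprod.total]

lemma addClosure_le_of_iso {M M' : D} (e : M ≅ M') : addClosure M ≤ addClosure M' := by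
  rintro N ⟨n, N', ⟨e'⟩⟩
  exact ⟨n, N', ⟨e' ≪≫ biproduct.mapIso fun _ => e⟩⟩

instance isTriangulatedClosed₂_leftPerpPos (M : D) : (leftPerpPos M).IsTriangulatedClosed₂ :=
  .mk' fun T hT h₁ h₃ k hk f => by
    obtain ⟨g, hg⟩ : ∃ g, f = T.mor₂ ≫ g := Triangle.yoneda_exact₂ _ hT f (h₁ k hk _)
    rw [hg, h₃ k hk g, comp_zero]

lemma leftPerpPos.eq_zero_of_addClosure {M Z N : D} (hZ : leftPerpPos M Z) (hN : addClosure M N)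
    {k : ℤ} (hk : 0 < k) (f : Z ⟶ N⟦k⟧) : f = 0 := by
  obtain ⟨n, p, i, hpi⟩ := addClosure_iff.1 hN
  calc f = f ≫ (∑ j, p j ≫ i j)⟦k⟧' := by rw [hpi]; simp
    _ = ∑ j, (f ≫ (p j)⟦k⟧') ≫ (i j)⟦k⟧' := by
      simp only [Functor.map_sum, Functor.map_comp, Preadditive.comp_sum, Category.assoc]
    _ = 0 := Finset.sum_eq_zero fun j _ => by rw [hZ k hk (f ≫ _), zero_comp]

end Classes

section NonnegShifts

variable {D : Type u} [Category.{v} D] [HasShift D ℤ] {P : ObjectProperty D}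

lemma le_shift_of_le_shift_neg_one [P.IsClosedUnderIsomorphisms] (hP : P ≤ P.shift (-1 : ℤ))
    {n : ℤ} (hn : n ≤ 0) : P ≤ P.shift n := by
  obtain ⟨n, rfl⟩ : ∃ m : ℕ, n = -m := ⟨n.natAbs, by lia⟩
  intro X hX
  induction n with
  | zero => exact P.prop_of_iso ((shiftFunctorZero' D _ (by simp)).symm.app X) hX
  | succ n ih =>
    exact P.prop_of_iso ((shiftFunctorAdd' D (-(n : ℤ)) (-1) _ (by lia)).symm.app X)
      (hP _ (ih (by lia)))

lemma prop_shift_of_le [P.IsClosedUnderIsomorphisms] (hP : P ≤ P.shift (-1 : ℤ)) {X : D}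
    {n m : ℤ} (h : P (X⟦n⟧)) (hm : m ≤ n) : P (X⟦m⟧) :=
  P.prop_of_iso ((shiftFunctorAdd' D n (m - n) m (by lia)).symm.app X)
    (le_shift_of_le_shift_neg_one hP (by lia) _ h)

instance isClosedUnderIsomorphisms_nonnegShifts : (nonnegShifts P).IsClosedUnderIsomorphisms where
  of_iso := by
    rintro X X' e ⟨C, n, hC, hn, ⟨e'⟩⟩
    exact ⟨C, n, hC, hn, ⟨e.symm ≪≫ e'⟩⟩

lemma nonnegShifts_iff [P.IsClosedUnderIsomorphisms] {X : D} :
    nonnegShifts P X ↔ ∃ n : ℤ, 0 ≤ n ∧ P (X⟦-n⟧) := by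
  constructor
  · rintro ⟨C, n, hC, hn, ⟨e⟩⟩
    exact ⟨n, hn, P.prop_of_iso
      ((shiftEquiv D n).unitIso.app C ≪≫ (shiftFunctor D (-n)).mapIso e.symm) hC⟩
  · rintro ⟨n, hn, h⟩
    exact ⟨X⟦-n⟧, n, h, hn, ⟨(shiftEquiv D n).counitIso.symm.app X⟩⟩

instance isStableUnderRetracts_nonnegShifts [P.IsStableUnderRetracts] :
    (nonnegShifts P).IsStableUnderRetracts where
  of_retract r h := by
    obtain ⟨n, hn, h⟩ := nonnegShifts_iff.1 h
    exact nonnegShifts_iff.2 ⟨n, hn, P.prop_of_retract (r.map (shiftFunctor D (-n))) h⟩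

variable [Preadditive D] [HasZeroObject D]
  [∀ n : ℤ, (shiftFunctor D n).Additive] [Pretriangulated D]

lemma isTriangulated_nonnegShifts [P.IsClosedUnderIsomorphisms] [P.ContainsZero]
    [P.IsTriangulatedClosed₂] (hP : P ≤ P.shift (-1 : ℤ)) : (nonnegShifts P).IsTriangulated where
  exists_zero := by
    obtain ⟨Z, hZ, h⟩ := P.exists_prop_of_containsZero
    exact ⟨Z, hZ, nonnegShifts_iff.2 ⟨0, le_rfl,
      P.prop_of_iso ((shiftFunctorZero' D _ (by simp)).symm.app Z) h⟩⟩
  isStableUnderShiftBy k :=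
    { le_shift X hX := by
        obtain ⟨n, -, h⟩ := nonnegShifts_iff.1 hX
        refine nonnegShifts_iff.2 ⟨max 0 (n + k), by simp, ?_⟩
        exact P.prop_of_iso ((shiftFunctorAdd' D k _ _ (by lia)).app X)
          (prop_shift_of_le hP h (m := k - max 0 (n + k)) (by lia)) }
  toIsTriangulatedClosed₂ := .mk' fun T hT h₁ h₃ => by
    obtain ⟨n, hn, h₁⟩ := nonnegShifts_iff.1 h₁
    obtain ⟨m, hm, h₃⟩ := nonnegShifts_iff.1 h₃
    exact nonnegShifts_iff.2 ⟨max n m, by lia, ((HasTriangle.of_distTriang T hT).shift _).prop₂ P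
      (prop_shift_of_le hP h₁ (by lia)) (prop_shift_of_le hP h₃ (by lia))⟩

end NonnegShifts

section Functors

universe v₁ v₂ u₁ u₂

variable {C : Type u₁} [Category.{v₁} C] [Preadditive C] [HasZeroObject C] [HasShift C ℤ]
  [∀ n : ℤ, (shiftFunctor C n).Additive] [Pretriangulated C]
  {D : Type u₂} [Category.{v₂} D] [Preadditive D] [HasZeroObject D] [HasShift D ℤ]
  [∀ n : ℤ, (shiftFunctor D n).Additive] [Pretriangulated D]

lemma addClosure.map {M N : C} (h : addClosure M N) (F : C ⥤ D) [F.Additive] :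
    addClosure (F.obj M) (F.obj N) := by
  obtain ⟨n, p, i, hpi⟩ := addClosure_iff.1 h
  exact addClosure_iff.2 ⟨n, fun j => F.map (p j), fun j => F.map (i j), by
    simp only [← F.map_comp, ← F.map_sum, hpi, F.map_id]⟩

variable (F : C ⥤ D) [F.CommShift ℤ] [F.IsTriangulated]

lemma HasTriangle.map {X Y Z : C} (H : HasTriangle X Y Z) :
    HasTriangle (F.obj X) (F.obj Y) (F.obj Z) := by
  obtain ⟨f, g, h, H⟩ := H
  exact .of_distTriang _ (F.map_distinguished _ H)

lemma HasTriangle.of_map [F.Full] [F.Faithful] {X Y Z : C}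
    (H : HasTriangle (F.obj X) (F.obj Y) (F.obj Z)) : HasTriangle X Y Z := by
  obtain ⟨f, g, h, H⟩ := H
  obtain ⟨f, rfl⟩ := F.map_surjective f
  obtain ⟨Z', g', h', H'⟩ := distinguished_cocone_triangle f
  let e := isoTriangleOfIso₁₂ _ _ (F.map_distinguished _ H') H (Iso.refl _) (Iso.refl _)
    (show F.map f ≫ 𝟙 (F.obj Y) = 𝟙 (F.obj X) ≫ F.map f by simp)
  exact .of_iso ⟨f, g', h', H'⟩ (Iso.refl X) (Iso.refl Y) (F.preimageIso (Triangle.π₃.mapIso e))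

instance isTriangulatedClosed₂_inverseImage (P : ObjectProperty D) [P.IsTriangulatedClosed₂]
    [P.IsClosedUnderIsomorphisms] : (P.inverseImage F).IsTriangulatedClosed₂ :=
  .mk' fun T hT h₁ h₃ => ((HasTriangle.of_distTriang T hT).map F).prop₂ P h₁ h₃

lemma HasCoresolution.map {P Q : ObjectProperty C} {P' Q' : ObjectProperty D}
    (hP : P ≤ P'.inverseImage F) (hQ : Q ≤ Q'.inverseImage F) {X : C}
    (h : HasCoresolution P Q X) : HasCoresolution P' Q' (F.obj X) := by
  obtain ⟨Y, N, ⟨e⟩, hN, hY, hT⟩ := h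
  exact ⟨fun i => F.obj (Y i), fun i => F.obj (N i), ⟨F.mapIso e⟩, fun i => hP _ (hN i),
    fun i => hQ _ (hY i), fun i => (hT i).map F⟩

end Functors

section Derived

variable {A : Type u} [Category.{v} A] [Abelian A] [HasDerivedCategory.{w} A]

open DerivedCategory Triangulated

lemma homologyIn_iff {a b : ℤ} {X : DerivedCategory.Bounded A} :
    homologyIn a b X ↔ TStructure.t.onBounded.IsGE X a ∧ TStructure.t.onBounded.IsLE X b := by
  rw [ObjectProperty.tStructure_isLE_iff, ObjectProperty.tStructure_isGE_iff]
  change _ ↔ X.obj.IsGE a ∧ X.obj.IsLE b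
  rw [isGE_iff, isLE_iff]
  refine ⟨fun h => ⟨fun i hi => h i ?_, fun i hi => h i ?_⟩, fun ⟨h, h'⟩ i hi => ?_⟩
  · simp only [Set.mem_Icc]; lia
  · simp only [Set.mem_Icc]; lia
  · rw [Set.mem_Icc, not_and_or, not_le, not_le] at hi
    exact hi.elim (h i) (h' i)

lemma exists_homologyIn (X : DerivedCategory.Bounded A) : ∃ a b, homologyIn a b X := by
  obtain ⟨⟨a, ha⟩, ⟨b, hb⟩⟩ := X.property
  exact ⟨a, b, homologyIn_iff.2 ⟨(ObjectProperty.tStructure_isGE_iff _ _ _ _).2 ha,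
    (ObjectProperty.tStructure_isLE_iff _ _ _ _).2 hb⟩⟩

lemma homologyIn_mono {a b a' b' : ℤ} (h : a' ≤ a) (h' : b ≤ b') :
    (homologyIn a b : ObjectProperty (DerivedCategory.Bounded A)) ≤ homologyIn a' b' :=
  fun _ hX i hi => hX i fun hi' => hi (Set.Icc_subset_Icc h h' hi')

lemma homologyIn.shift {a b : ℤ} {X : DerivedCategory.Bounded A} (h : homologyIn a b X) (n : ℤ)
    {a' b' : ℤ} (ha : n + a' = a) (hb : n + b' = b) : homologyIn a' b' (X⟦n⟧) := by
  obtain ⟨_, _⟩ := homologyIn_iff.1 h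
  exact homologyIn_iff.2 ⟨TStructure.t.onBounded.isGE_shift X a n a' ha,
    TStructure.t.onBounded.isLE_shift X b n b' hb⟩

lemma homologyIn_of_isZero (a b : ℤ) {X : DerivedCategory.Bounded A} (h : IsZero X) :
    homologyIn a b X := fun i _ =>
  (DerivedCategory.Bounded.ι ⋙ homologyFunctor A i).map_isZero h

instance isStableUnderRetracts_homologyIn (a b : ℤ) :
    (homologyIn a b : ObjectProperty (DerivedCategory.Bounded A)).IsStableUnderRetracts where
  of_retract r h i hi :=
    (h i hi).of_mono (r.map (DerivedCategory.Bounded.ι ⋙ homologyFunctor A i)).i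

instance isTriangulatedClosed₂_homologyIn (a b : ℤ) :
    (homologyIn a b : ObjectProperty (DerivedCategory.Bounded A)).IsTriangulatedClosed₂ :=
  .mk' fun T hT h₁ h₃ => by
    rw [homologyIn_iff] at h₁ h₃ ⊢
    exact ⟨TStructure.t.onBounded.isGE₂ T hT a h₁.1 h₃.1,
      TStructure.t.onBounded.isLE₂ T hT b h₁.2 h₃.2⟩

lemma isZero_of_homologyIn {a b : ℤ} {X : DerivedCategory.Bounded A} (h : homologyIn a b X)
    (hab : b < a) : IsZero X := by
  obtain ⟨_, _⟩ := homologyIn_iff.1 h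
  exact TStructure.t.onBounded.isZero X b a hab

lemma exists_truncation_hasTriangle {a c : ℤ} {X : DerivedCategory.Bounded A}
    (h : homologyIn a c X) (hac : a ≤ c) :
    ∃ X' X'', homologyIn a (c - 1) X' ∧ homologyIn c c X'' ∧ HasTriangle X' X X'' := by
  obtain ⟨X', X'', h', h'', f, g, δ, H⟩ :=
    TStructure.t.onBounded.exists_triangle X (c - 1) c (by lia)
  obtain ⟨hGE, hLE⟩ := homologyIn_iff.1 h
  have : TStructure.t.onBounded.IsGE X'' c := ⟨h''⟩
  have : TStructure.t.onBounded.IsLE X' (c - 1) := ⟨h'⟩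
  refine ⟨X', X'', homologyIn_iff.2 ⟨?_, ⟨h'⟩⟩, homologyIn_iff.2 ⟨⟨h''⟩, ?_⟩, ⟨f, g, δ, H⟩⟩
  · refine TStructure.t.onBounded.isGE₂ _ (inv_rot_of_distTriang _ H) a ?_ hGE
    have := TStructure.t.onBounded.isGE_shift X'' c (-1) (c + 1)
    exact TStructure.t.onBounded.isGE_of_ge (X''⟦(-1 : ℤ)⟧) a (c + 1)
  · refine TStructure.t.onBounded.isLE₂ _ (rot_of_distTriang _ H) c hLE ?_
    have := TStructure.t.onBounded.isLE_shift X' (c - 1) 1 (c - 2)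
    exact TStructure.t.onBounded.isLE_of_le (X'⟦(1 : ℤ)⟧) (c - 2) c

/-- The embedding `A ⥤ D^b(A)` sending an object to the complex concentrated in degree `0`. -/
noncomputable def stalk : A ⥤ DerivedCategory.Bounded A :=
  ObjectProperty.lift _ (singleFunctor A 0) fun _ => ⟨⟨0, inferInstance⟩, ⟨0, inferInstance⟩⟩

instance additive_stalk : (stalk (A := A)).Additive where
  map_add := (ObjectProperty.ι _).map_injective (singleFunctor A 0).map_add

lemma homologyIn_stalk (M : A) : homologyIn 0 0 (stalk.obj M) := by
  rw [homologyIn_iff, ObjectProperty.tStructure_isLE_iff, ObjectProperty.tStructure_isGE_iff]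
  exact ⟨inferInstanceAs ((singleFunctor A 0).obj M |>.IsGE 0),
    inferInstanceAs ((singleFunctor A 0).obj M |>.IsLE 0)⟩

lemma exists_iso_stalk {X : DerivedCategory.Bounded A} (h : homologyIn 0 0 X) :
    ∃ M : A, Nonempty (X ≅ stalk.obj M) := by
  rw [homologyIn_iff, ObjectProperty.tStructure_isLE_iff, ObjectProperty.tStructure_isGE_iff] at h
  have : X.obj.IsGE 0 := h.1
  have : X.obj.IsLE 0 := h.2
  obtain ⟨M, ⟨e⟩⟩ := exists_iso_singleFunctor_obj_of_isGE_of_isLE X.obj 0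
  exact ⟨M, ⟨(ObjectProperty.fullyFaithfulι _).preimageIso (X := X) (Y := stalk.obj M) e⟩⟩

lemma exists_iso_stalk_shift {X : DerivedCategory.Bounded A} {i : ℤ} (h : homologyIn i i X) :
    ∃ M : A, Nonempty (X ≅ (stalk.obj M)⟦-i⟧) := by
  obtain ⟨M, ⟨e⟩⟩ := exists_iso_stalk (h.shift i (add_zero i) (add_zero i))
  exact ⟨M, ⟨(shiftEquiv _ i).unitIso.app X ≪≫ (shiftFunctor _ (-i)).mapIso e⟩⟩

lemma hasTriangle_stalk {S : ShortComplex A} (hS : S.ShortExact) :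
    HasTriangle (stalk.obj S.X₁) (stalk.obj S.X₂) (stalk.obj S.X₃) :=
  .of_map DerivedCategory.Bounded.ι (.of_distTriang _ hS.singleTriangle_distinguished)

lemma homologyIn_le {P : ObjectProperty (DerivedCategory.Bounded A)} [P.IsTriangulatedClosed₂]
    [P.IsClosedUnderIsomorphisms] (h0 : ∀ X, IsZero X → P X) {a b : ℤ}
    (h : ∀ (M : A) (i : ℤ), a ≤ i → i ≤ b → P ((stalk.obj M)⟦-i⟧)) : homologyIn a b ≤ P := by
  by_cases hab : b < a
  · exact fun X hX => h0 X (isZero_of_homologyIn hX hab)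
  obtain ⟨n, rfl⟩ : ∃ n : ℕ, b = a + n - 1 := ⟨(b - a + 1).natAbs, by lia⟩
  clear hab
  induction n with
  | zero => exact fun X hX => h0 X (isZero_of_homologyIn hX (by simp))
  | succ n ih =>
    intro X hX
    obtain ⟨X', X'', hX', hX'', H⟩ := exists_truncation_hasTriangle hX (by lia)
    obtain ⟨M, ⟨e⟩⟩ := exists_iso_stalk_shift hX''
    exact H.prop₂ P
      (ih (fun M i h₁ h₂ => h M i h₁ (by lia)) _ (homologyIn_mono le_rfl (by lia) _ hX'))
      (P.prop_of_iso e.symm (h M _ (by lia) le_rfl))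

lemma eq_zero_of_projective {Q : A} [Projective Q] {a b : ℤ} {Y : DerivedCategory.Bounded A}
    (h : homologyIn a b Y) (hb : b < 0) (f : stalk.obj Q ⟶ Y) : f = 0 := by
  rw [homologyIn_iff, ObjectProperty.tStructure_isLE_iff] at h
  have : Y.obj.IsLE b := h.2
  obtain ⟨L, _, ⟨e⟩⟩ := exists_iso_Q_obj_of_isLE Y.obj b
  let e' : (DerivedCategory.Q).obj ((CochainComplex.singleFunctor A 0).obj Q) ≅
      DerivedCategory.Bounded.ι.obj (stalk.obj Q) := (singleFunctorIsoCompQ A 0).symm.app Q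
  apply DerivedCategory.Bounded.ι.map_injective
  rw [Functor.map_zero, ← cancel_epi e'.hom, ← cancel_mono e.hom, comp_zero, zero_comp]
  exact from_singleFunctor_obj_eq_zero_of_projective _ b hb

section EnoughProjectives

variable (P : ObjectProperty (DerivedCategory.Bounded A))
  (hP : ∀ M : A, ∃ (Q : A) (π : Q ⟶ M), Projective Q ∧ Epi π ∧ P (stalk.obj Q))

include hP

lemma exists_projective_hasTriangle {X : DerivedCategory.Bounded A} (hX : homologyIn 0 0 X) :
    ∃ (Q : A) (C : DerivedCategory.Bounded A), Projective Q ∧ P (stalk.obj Q) ∧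
      homologyIn (-1) (-1) C ∧ HasTriangle (stalk.obj Q) X C := by
  obtain ⟨M, ⟨e⟩⟩ := exists_iso_stalk hX
  obtain ⟨Q, π, hQ, hπ, hPQ⟩ := hP M
  have hS : (ShortComplex.mk (kernel.ι π) π (kernel.condition π)).ShortExact :=
    .mk' (ShortComplex.exact_kernel π) inferInstance hπ
  exact ⟨Q, (stalk.obj (kernel π))⟦(1 : ℤ)⟧, hQ, hPQ, (homologyIn_stalk _).shift 1 rfl rfl,
    (hasTriangle_stalk hS).rotate.of_iso (Iso.refl _) e.symm (Iso.refl _)⟩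

lemma homologyIn_zero_le_extensionProduct {a : ℤ} (ha : a ≤ 0) :
    homologyIn a 0 ≤ P.extensionProduct (homologyIn (min a (-1)) (-1)) := by
  intro X hX
  obtain ⟨X', X'', hX', hX'', hXX⟩ := exists_truncation_hasTriangle hX ha
  obtain ⟨Q, C, hQ, hPQ, hC, hQC⟩ := exists_projective_hasTriangle P hP hX''
  have hX1 : homologyIn (a - 1) (-2) (X'⟦(1 : ℤ)⟧) := hX'.shift 1 (by lia) (by lia)
  obtain ⟨V, ⟨f, g, h, hV⟩, hV'⟩ :=
    hXX.exists_lift hQC fun φ => eq_zero_of_projective hX1 (by lia) φ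
  exact ⟨_, V, f, g, h, hV, hPQ, hV'.prop₂ _
    (homologyIn_mono (by lia) (by lia) _ hX') (homologyIn_mono (by lia) le_rfl _ hC)⟩

variable [P.IsTriangulated]

lemma homologyIn_le_extensionProduct {a c : ℤ} (hac : a ≤ c) :
    homologyIn a c ≤ P.extensionProduct (homologyIn (min a (c - 1)) (c - 1)) := by
  intro X hX
  obtain ⟨W, V, f, g, h, H, hW, hV⟩ := homologyIn_zero_le_extensionProduct P hP
    (a := a - c) (by lia) _ (hX.shift c (by lia) (by lia))
  refine ObjectProperty.prop_of_iso _ ((shiftEquiv _ c).unitIso.symm.app X)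
    ⟨_, _, _, _, _, Triangle.shift_distinguished _ H (-c), P.le_shift _ _ hW, ?_⟩
  exact hV.shift (-c) (by lia) (by lia)

lemma homologyIn_le_extensionProduct_sub [P.IsClosedUnderIsomorphisms] {a c : ℤ} (n : ℕ) :
    homologyIn a c ≤ P.extensionProduct (homologyIn (min a (c - n)) (c - n)) := by
  induction n with
  | zero =>
    exact (homologyIn_mono (by simp) (by simp)).trans (P.le_extensionProduct_right)
  | succ n ih =>
    calc homologyIn a c ≤ P.extensionProduct (homologyIn (min a (c - n)) (c - n)) := ih
      _ ≤ P.extensionProduct (P.extensionProduct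
          (homologyIn (min (min a (c - n)) (c - n - 1)) (c - n - 1))) :=
        ObjectProperty.monotone_extensionProduct_right _
          (homologyIn_le_extensionProduct P hP (by lia))
      _ = (P.extensionProduct P).extensionProduct _ :=
        (ObjectProperty.extensionProduct_assoc _ _ _).symm
      _ ≤ P.extensionProduct (homologyIn (min (min a (c - n)) (c - n - 1)) (c - n - 1)) :=
        ObjectProperty.monotone_extensionProduct_left _
          (ObjectProperty.extensionProduct_le_of_isTriangulatedClosed₂ le_rfl le_rfl)
      _ ≤ P.extensionProduct (homologyIn (min a (c - ↑(n + 1))) (c - ↑(n + 1))) :=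
        ObjectProperty.monotone_extensionProduct_right _ (homologyIn_mono (by lia) (by lia))

/-- A projective approximation whose cone is a stalk complex in sufficiently negative degree
splits. -/
lemma prop_of_finite_projectiveDimension [P.IsStableUnderRetracts]
    {X : DerivedCategory.Bounded A} {i₀ : ℤ}
    (h : ∀ (M : A) (i : ℤ), i₀ ≤ i → ∀ f : X ⟶ (stalk.obj M)⟦i⟧, f = 0) : P X := by
  obtain ⟨a, c, hX⟩ := exists_homologyIn X
  obtain ⟨W, V, f, g, δ, H, hW, hV⟩ := homologyIn_le_extensionProduct_sub P hP
    ((c - a).natAbs + (c + i₀).natAbs) _ hX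
  rw [min_eq_right (by lia)] at hV
  obtain ⟨M, ⟨e⟩⟩ := exists_iso_stalk_shift hV
  have hg : g = 0 := by rw [← cancel_mono e.hom, zero_comp, h M _ (by lia) (g ≫ e.hom)]
  obtain ⟨s, hs⟩ : ∃ s : X ⟶ W, 𝟙 X = s ≫ f :=
    Triangle.coyoneda_exact₂ _ H (𝟙 X) (show 𝟙 X ≫ g = 0 by rw [hg, comp_zero])
  exact P.prop_of_retract ⟨s, f, hs.symm⟩ hW

end EnoughProjectives

end Derived

section CoAuslander

open scoped ZeroObject

variable {A : Type u} [Category.{v} A] [Abelian A] [HasDerivedCategory.{w} A]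
  (T : DerivedCategory.Bounded A)

lemma coAuslanderIn_eq (a b : ℤ) :
    coAuslanderIn T a b = HasCoresolution (addClosure T) (leftPerpPos T ⊓ homologyIn a b) :=
  funext fun _ => propext ⟨fun h => h.2, fun h => ⟨h.prop.1, h⟩⟩

lemma coAuslanderIn_mono {a b a' b' : ℤ} (ha : a' ≤ a) (hb : b ≤ b') :
    coAuslanderIn T a b ≤ coAuslanderIn T a' b' := by
  rw [coAuslanderIn_eq, coAuslanderIn_eq]
  exact HasCoresolution.mono (inf_le_inf_left _ (homologyIn_mono ha hb))

lemma coAuslanderIn_of_isZero (a b : ℤ) {X : DerivedCategory.Bounded A} (h : IsZero X) :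
    coAuslanderIn T a b X := by
  rw [coAuslanderIn_eq]
  exact .of_isZero h (addClosure_of_isZero T h)
    ⟨leftPerpPos_of_isZero T h, homologyIn_of_isZero a b h⟩

lemma coAuslanderIn_le_shift (a b : ℤ) :
    coAuslanderIn T a b ≤ (coAuslanderIn T a (b + 1)).shift (-1 : ℤ) := by
  intro X hX
  have hX' := coAuslanderIn_mono T le_rfl (show b ≤ b + 1 by lia) X hX
  rw [coAuslanderIn_eq] at hX hX'
  rw [ObjectProperty.prop_shift_iff, coAuslanderIn_eq]
  have hT : HasTriangle (X⟦(-1 : ℤ)⟧) 0 X :=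
    HasTriangle.invRotate ⟨_, _, _, contractible_distinguished₁ X⟩
  exact .cons ⟨leftPerpPos_le_shift T (by simp) _ hX.prop.1, homologyIn_mono (by lia) le_rfl _
    (hX.prop.2.shift (-1) (a' := a + 1) (by lia) (by lia))⟩
    (addClosure_of_isZero T (isZero_zero _)) hT hX'

instance isTriangulatedClosed₂_coAuslanderIn (a b : ℤ) :
    (coAuslanderIn T a b).IsTriangulatedClosed₂ := by
  rw [coAuslanderIn_eq]
  exact HasCoresolution.isTriangulatedClosed₂ (fun _ _ => addClosure_biprod)
    fun _ _ hZ hN => hZ.1.eq_zero_of_addClosure hN one_pos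

instance isStableUnderRetracts_coAuslanderIn (a b : ℤ) :
    (coAuslanderIn T a b).IsStableUnderRetracts := by
  rw [coAuslanderIn_eq]
  exact HasCoresolution.isStableUnderRetracts (fun _ _ => addClosure_biprod)
    fun _ _ hZ hN => hZ.1.eq_zero_of_addClosure hN one_pos

variable {T} in
lemma coAuslander_iff {X : DerivedCategory.Bounded A} :
    coAuslander T X ↔ ∃ a b, coAuslanderIn T a b X := by
  constructor
  · rintro ⟨a, b, -, h⟩
    exact ⟨a, b, h⟩
  · rintro ⟨a, b, h⟩
    obtain ⟨a', b', h'⟩ := exists_homologyIn T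
    exact ⟨min a a', max b b', homologyIn_mono (by simp) (by simp) _ h',
      coAuslanderIn_mono T (by simp) (by simp) _ h⟩

instance isStableUnderRetracts_coAuslander : (coAuslander T).IsStableUnderRetracts where
  of_retract r h := by
    obtain ⟨a, b, h⟩ := coAuslander_iff.1 h
    exact coAuslander_iff.2 ⟨a, b, ObjectProperty.prop_of_retract _ r h⟩

instance containsZero_coAuslander : (coAuslander T).ContainsZero where
  exists_zero := ⟨0, isZero_zero _,
    coAuslander_iff.2 ⟨0, 0, coAuslanderIn_of_isZero T 0 0 (isZero_zero _)⟩⟩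

instance isTriangulatedClosed₂_coAuslander : (coAuslander T).IsTriangulatedClosed₂ :=
  .mk' fun Δ hΔ h₁ h₃ => by
    obtain ⟨a, b, h₁⟩ := coAuslander_iff.1 h₁
    obtain ⟨a', b', h₃⟩ := coAuslander_iff.1 h₃
    exact coAuslander_iff.2 ⟨min a a', max b b',
      ObjectProperty.ext_of_isTriangulatedClosed₂ _ Δ hΔ
        (coAuslanderIn_mono T (by simp) (by simp) _ h₁)
        (coAuslanderIn_mono T (by simp) (by simp) _ h₃)⟩

lemma coAuslander_le_shift : coAuslander T ≤ (coAuslander T).shift (-1 : ℤ) := by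
  intro X hX
  obtain ⟨a, b, h⟩ := coAuslander_iff.1 hX
  exact coAuslander_iff.2 ⟨a, b + 1, coAuslanderIn_le_shift T a b X h⟩

instance isTriangulated_nonnegShifts_coAuslander : (nonnegShifts (coAuslander T)).IsTriangulated :=
  isTriangulated_nonnegShifts (coAuslander_le_shift T)

end CoAuslander

section Generators

variable {A : Type u} [Category.{v} A] [Abelian A]

attribute [local instance] Abelian.hasFiniteBiproducts

/-- `G` is a progenerator of `A`: it is projective and every object of `A` is a quotient of a
finite direct sum of copies of `G`. -/
def IsProgenerator (G : A) : Prop :=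
  Projective G ∧ ∀ M : A, ∃ (n : ℕ) (π : (⨁ fun _ : Fin n => G) ⟶ M), Epi π

/-- `L` generates `A` under extensions and direct summands. For finitely generated modules over an
artinian ring, `L` may be taken to be the sum of the simple modules. -/
def IsExtensionGenerator (L : A) : Prop :=
  ∀ (P : ObjectProperty A) [P.IsStableUnderRetracts] [P.IsClosedUnderExtensions],
    P L → ∀ M, P M

lemma projective_biproduct {J : Type*} (G : J → A) [HasBiproduct G] [∀ j, Projective (G j)] :
    Projective (⨁ G) where
  factors f e _ :=
    ⟨biproduct.desc fun j => Projective.factorThru (biproduct.ι G j ≫ f) e, by cat_disch⟩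

variable [HasDerivedCategory.{w} A] (P : ObjectProperty (DerivedCategory.Bounded A))

lemma IsProgenerator.exists_projective_epi {G : A} (hG : IsProgenerator G) [P.IsTriangulated]
    [P.IsClosedUnderIsomorphisms] (hP : P (stalk.obj G)) (M : A) :
    ∃ (Q : A) (π : Q ⟶ M), Projective Q ∧ Epi π ∧ P (stalk.obj Q) := by
  obtain ⟨hG, h⟩ := hG
  obtain ⟨n, π, hπ⟩ := h M
  exact ⟨_, π, projective_biproduct _, hπ, P.prop_of_iso
    ((stalk.mapBiproduct fun _ : Fin n => G) ≪≫ biproduct.isoProduct _).symm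
    (P.prop_pi _ fun _ => hP)⟩

instance isClosedUnderExtensions_inverseImage_stalk [P.IsTriangulatedClosed₂]
    [P.IsClosedUnderIsomorphisms] (i : ℤ) :
    (P.inverseImage (stalk ⋙ shiftFunctor _ i)).IsClosedUnderExtensions where
  prop_X₂_of_shortExact hS h₁ h₃ := ((hasTriangle_stalk hS).shift i).prop₂ P h₁ h₃

lemma IsExtensionGenerator.prop_stalk_shift {L : A} (hL : IsExtensionGenerator L)
    [P.IsStableUnderRetracts] [P.IsTriangulatedClosed₂] {i : ℤ}
    (hP : P ((stalk.obj L)⟦i⟧)) (M : A) : P ((stalk.obj M)⟦i⟧) :=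
  hL (P.inverseImage (stalk ⋙ shiftFunctor _ i)) hP M

end Generators

section Equivalences

variable {A : Type u} [Category.{v} A] [Abelian A] [HasDerivedCategory.{w} A]

/-- The object `T` of `D^b(A)` is Wakamatsu-silting relative to `G`, which plays the role of the
regular module: it is semi-selforthogonal and `G ∈ ⟨𝒳_T^♭⟩₊`. -/
def IsWakamatsuSiltingFor (G : A) (T : DerivedCategory.Bounded A) : Prop :=
  IsSemiSelforthogonal T ∧ nonnegShifts (coAuslander T) (stalk.obj G)

instance isStableUnderRetracts_rightOrthogonal {C : Type*} [Category* C] [HasZeroMorphisms C]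
    (P : ObjectProperty C) : P.rightOrthogonal.IsStableUnderRetracts where
  of_retract r h _ f hX := by
    rw [← Category.comp_id f, ← r.retract, ← Category.assoc, h (f ≫ r.i) hX, zero_comp]

lemma rightOrthogonal_singleton_iff {C : Type*} [Category* C] [HasZeroMorphisms C] {X Y : C} :
    (ObjectProperty.singleton X).rightOrthogonal Y ↔ ∀ f : X ⟶ Y, f = 0 :=
  ⟨fun h f => h f ⟨()⟩, by rintro h _ f ⟨_⟩; exact h f⟩

variable {B : Type*} [Category* B] [Abelian B] [HasDerivedCategory.{w'} B] {L G : A} {G' : B}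
  (hL : IsExtensionGenerator L) (F : DerivedCategory.Bounded A ⥤ DerivedCategory.Bounded B)
  [F.CommShift ℤ] [F.IsTriangulated]

include hL

lemma exists_homologyIn_le_inverseImage (a b : ℤ) :
    ∃ a' b', homologyIn a b ≤ (homologyIn a' b').inverseImage F := by
  obtain ⟨c, d, h⟩ := exists_homologyIn (F.obj (stalk.obj L))
  let P := (homologyIn (c + a) (d + b)).inverseImage F
  refine ⟨c + a, d + b, homologyIn_le (P := P)
    (fun X hX => homologyIn_of_isZero _ _ (F.map_isZero hX))
    fun M i hi hi' => hL.prop_stalk_shift P ?_ M⟩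
  exact ObjectProperty.prop_of_iso (homologyIn _ _) ((F.commShiftIso (-i)).symm.app _)
    (homologyIn_mono (by lia) (by lia) _
      (h.shift (-i) (a' := c + i) (b' := d + i) (by lia) (by lia)))

lemma coAuslander.map [F.Full] {T X : DerivedCategory.Bounded A} {T' : DerivedCategory.Bounded B}
    (e : F.obj T ≅ T') (h : coAuslander T X) : coAuslander T' (F.obj X) := by
  obtain ⟨a, b, h⟩ := coAuslander_iff.1 h
  obtain ⟨a', b', hF⟩ := exists_homologyIn_le_inverseImage hL F a b
  rw [coAuslanderIn_eq] at h
  refine coAuslander_iff.2 ⟨a', b', ?_⟩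
  rw [coAuslanderIn_eq]
  refine HasCoresolution.map F ?_ ?_ h
  · exact fun N hN => addClosure_le_of_iso e _ (hN.map F)
  · exact fun Y hY => ⟨leftPerpPos_le_of_iso e _ (hY.1.map F), hF _ hY.2⟩

lemma nonnegShifts_coAuslander_map [F.Full] {T X : DerivedCategory.Bounded A}
    {T' : DerivedCategory.Bounded B} (e : F.obj T ≅ T') (h : nonnegShifts (coAuslander T) X) :
    nonnegShifts (coAuslander T') (F.obj X) := by
  obtain ⟨C, n, hC, hn, ⟨e'⟩⟩ := h
  exact ⟨F.obj C, n, hC.map hL F e, hn, ⟨F.mapIso e' ≪≫ (F.commShiftIso n).app C⟩⟩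

lemma exists_finite_projectiveDimension [F.Faithful] [Projective G']
    {X : DerivedCategory.Bounded A} (e : F.obj X ≅ stalk.obj G') :
    ∃ i₀ : ℤ, ∀ (M : A) (i : ℤ), i₀ ≤ i → ∀ f : X ⟶ (stalk.obj M)⟦i⟧, f = 0 := by
  obtain ⟨c, d, h⟩ := exists_homologyIn (F.obj (stalk.obj L))
  refine ⟨d + 1, fun M i hi => rightOrthogonal_singleton_iff.1
    (hL.prop_stalk_shift (ObjectProperty.singleton X).rightOrthogonal ?_ M)⟩
  refine rightOrthogonal_singleton_iff.2 fun f => ?_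
  have hi' := h.shift i (a' := c - i) (b' := d - i) (by lia) (by lia)
  apply F.map_injective
  rw [F.map_zero, ← cancel_epi e.inv, ← cancel_mono ((F.commShiftIso i).hom.app (stalk.obj L)),
    comp_zero, zero_comp]
  exact eq_zero_of_projective hi' (by lia) _

lemma IsWakamatsuSiltingFor.map [F.IsEquivalence] (hG : IsProgenerator G) [Projective G']
    {T : DerivedCategory.Bounded A} {T' : DerivedCategory.Bounded B} (e : F.obj T ≅ T')
    (h : IsWakamatsuSiltingFor G T) : IsWakamatsuSiltingFor G' T' := by
  obtain ⟨hT, hGT⟩ := h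
  have hFT : leftPerpPos (F.obj T) (F.obj T) := leftPerpPos.map hT F
  refine ⟨leftPerpPos_le_of_iso e _ ((leftPerpPos _).prop_of_iso e hFT), ?_⟩
  let e' := F.objObjPreimageIso (stalk.obj G')
  obtain ⟨i₀, hi₀⟩ := exists_finite_projectiveDimension hL F e'
  let P := (nonnegShifts (coAuslander T')).inverseImage F
  have hP : P (stalk.obj G) := nonnegShifts_coAuslander_map hL F e hGT
  exact ObjectProperty.prop_of_iso _ e'
    (prop_of_finite_projectiveDimension P (hG.exists_projective_epi P hP) hi₀)

end Equivalences

section Modules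

variable (R : Type u) [Ring R] [IsNoetherianRing R]

lemma exists_shortExact_submodule {M : Type u} [AddCommGroup M] [Module R M]
    [Module.Finite R M] (N : Submodule R M) :
    ∃ (f : FGModuleCat.of R N ⟶ FGModuleCat.of R M)
      (g : FGModuleCat.of R M ⟶ FGModuleCat.of R (M ⧸ N)) (h : f ≫ g = 0),
      (ShortComplex.mk f g h).ShortExact := by
  refine ⟨FGModuleCat.ofHom N.subtype, FGModuleCat.ofHom N.mkQ, ?_, ?_⟩
  · ext x
    exact (Submodule.Quotient.mk_eq_zero N).2 x.2
  · refine ShortExact.reflects_shortExact_of_faithful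
      (forget₂ (FGModuleCat.{u} R) (ModuleCat.{u} R)) ?_
    refine ModuleCat.shortComplex_shortExact _ ?_ N.injective_subtype N.mkQ_surjective
    exact LinearMap.exact_subtype_mkQ N

lemma fgModuleCat_epi_iff_surjective {M N : FGModuleCat.{u} R} (f : M ⟶ N) :
    Epi f ↔ Function.Surjective f.hom.hom := by
  rw [← ModuleCat.epi_iff_surjective]
  exact ((forget₂ (FGModuleCat.{u} R) (ModuleCat.{u} R)).epi_map_iff_epi f).symm

lemma fgModuleCat_projective {M : Type u} [AddCommGroup M] [Module R M]
    [Module.Finite R M] [Module.Projective R M] : Projective (FGModuleCat.of R M) where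
  factors f e he := by
    obtain ⟨h, hh⟩ := Module.projective_lifting_property e.hom.hom f.hom.hom
      ((fgModuleCat_epi_iff_surjective R e).1 he)
    exact ⟨FGModuleCat.ofHom h, by ext x; exact LinearMap.congr_fun hh x⟩

attribute [local instance] Abelian.hasFiniteBiproducts

lemma isProgenerator_of_self : IsProgenerator (FGModuleCat.of R R) := by
  refine ⟨fgModuleCat_projective R, fun M => ?_⟩
  obtain ⟨n, s, hs⟩ := Module.Finite.exists_fin (R := R) (M := M)
  refine ⟨n, biproduct.desc fun j => FGModuleCat.ofHom (LinearMap.toSpanSingleton R M (s j)),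
    ⟨fun {N} g h hgh => ?_⟩⟩
  have hgen (j : Fin n) : g.hom.hom (s j) = h.hom.hom (s j) := by
    have hj := biproduct.ι (fun _ : Fin n => FGModuleCat.of R R) j ≫= hgh
    simp only [biproduct.ι_desc_assoc] at hj
    have hj' : g.hom.hom ((1 : R) • s j) = h.hom.hom ((1 : R) • s j) :=
      LinearMap.congr_fun (congrArg (fun φ => φ.hom.hom) hj) (1 : R)
    rwa [one_smul] at hj'
  refine FGModuleCat.hom_ext (LinearMap.ext_on hs ?_)
  rintro _ ⟨j, rfl⟩
  exact hgen j

end Modules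

section Artinian

variable (R : Type u) [Ring R] [IsArtinianRing R]

lemma exists_section_of_isSimpleModule {L : Type u} [AddCommGroup L] [Module R L]
    [IsSimpleModule R L] :
    ∃ (i : L →ₗ[R] R ⧸ Ring.jacobson R) (r : R ⧸ Ring.jacobson R →ₗ[R] L),
      r ∘ₗ i = LinearMap.id := by
  have : IsSemisimpleModule R (R ⧸ Ring.jacobson R) :=
    (IsArtinian.isSemisimpleModule_iff_jacobson R _).2 (Module.jacobson_quotient_jacobson R R)
  obtain ⟨I, hI, ⟨e⟩⟩ := isSimpleModule_iff_quot_maximal.1 ‹IsSimpleModule R L›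
  let r : R ⧸ Ring.jacobson R →ₗ[R] L :=
    e.symm.toLinearMap ∘ₗ Submodule.factor (Ring.jacobson_le_of_isMaximal I)
  obtain ⟨i, hi⟩ := IsSemisimpleModule.lifting_property r
    (e.symm.surjective.comp (Submodule.factor_surjective _)) LinearMap.id
  exact ⟨i, r, hi⟩

/-- `R / rad R`, the largest semisimple quotient of the artinian ring `R`, as a finitely generated
module. Every simple module is one of its direct summands. -/
abbrev semisimpleTop : FGModuleCat.{u} R := FGModuleCat.of R (R ⧸ Ring.jacobson R)

lemma isExtensionGenerator_semisimpleTop : IsExtensionGenerator (semisimpleTop R) := by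
  intro P _ _ hP M
  have hM : IsFiniteLength R M :=
    isFiniteLength_iff_isNoetherian_isArtinian.2 ⟨inferInstance, inferInstance⟩
  suffices ∀ (M : Type u) [AddCommGroup M] [Module R M] (_ : IsFiniteLength R M)
      [Module.Finite R M], P (FGModuleCat.of R M) from this M hM
  intro M _ _ hM
  induction hM with
  | of_subsingleton =>
    intro _
    exact P.prop_of_retract ⟨0, 0, by ext x; exact Subsingleton.elim _ _⟩ hP
  | @of_simple_quotient M _ _ N _ _ ih =>
    intro _
    obtain ⟨f, g, h, hS⟩ := exists_shortExact_submodule R N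
    obtain ⟨i, r, hir⟩ := exists_section_of_isSimpleModule R (L := M ⧸ N)
    exact P.prop_X₂_of_shortExact hS ih (P.prop_of_retract ⟨FGModuleCat.ofHom i,
      FGModuleCat.ofHom r, by ext x; exact LinearMap.congr_fun hir (N.mkQ x)⟩ hP)

end Artinian

instance isArtinianRing_of_isArtinAlgebra (R : Type u) [Ring R] [IsArtinAlgebra R] :
    IsArtinianRing R := by
  obtain ⟨k, _, _, _, _⟩ := IsArtinAlgebra.exists_base (R := R)
  have : IsArtinian k R := inferInstance
  exact isArtinian_of_tower k this

end WakamatsuSilting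

open WakamatsuSilting in
theorem corollary3p3_general {A : Type*} [Category* A] [Abelian A] [HasDerivedCategory.{w} A]
    {B : Type*} [Category* B] [Abelian B] [HasDerivedCategory.{w'} B]
    {G L : A} (hG : IsProgenerator G)
    (hL : IsExtensionGenerator L)
    {G' L' : B} (hG' : IsProgenerator G')
    (hL' : IsExtensionGenerator L')
    (F : DerivedCategory.Bounded A ⥤ DerivedCategory.Bounded B)
    [F.CommShift ℤ] [F.IsTriangulated] [F.IsEquivalence] (T : DerivedCategory.Bounded A) :
    IsWakamatsuSiltingFor G T ↔
      IsWakamatsuSiltingFor G' (F.obj T) := by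
  have := hG.1
  have := hG'.1
  refine ⟨fun h => h.map hL F hG (Iso.refl _), fun h => ?_⟩
  obtain ⟨E, rfl⟩ : ∃ E : DerivedCategory.Bounded A ≌ DerivedCategory.Bounded B, E.functor = F :=
    ⟨F.asEquivalence, rfl⟩
  let := E.commShiftInverse ℤ
  have := E.commShift_of_functor ℤ
  have : E.IsTriangulated := .mk' E inferInstance
  exact h.map hL' E.inverse hG' (E.unitIso.symm.app T)

theorem corollary3p3 {R : Type u} [Ring R] [IsArtinAlgebra R]
    {S : Type v} [Ring S] [IsArtinAlgebra S]
    [HasDerivedCategory.{w} (FGModuleCat.{u} R)] [HasDerivedCategory.{w'} (FGModuleCat.{v} S)]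
    (F : WakamatsuSilting.Db R ⥤ WakamatsuSilting.Db S)
    [F.CommShift ℤ] [F.IsTriangulated] [F.IsEquivalence]
    (T : WakamatsuSilting.Db R) :
    WakamatsuSilting.IsWakamatsuSilting T ↔ WakamatsuSilting.IsWakamatsuSilting (F.obj T) :=
  corollary3p3_general (WakamatsuSilting.isProgenerator_of_self R)
    (WakamatsuSilting.isExtensionGenerator_semisimpleTop R)
    (WakamatsuSilting.isProgenerator_of_self S)
    (WakamatsuSilting.isExtensionGenerator_semisimpleTop S) F T
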